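/- Let $\mathbf{T}=\{z\in\mathbb{C}:|z|=1\}$ and let $\alpha$ be the normalized Haar measure on $\mathbf{T}$. For a continuous potential $Q:\mathbf{T}\to\mathbb{R}$ and a Borel probability measure $\mu$ on $\mathbf{T}$ let $$E_Q(\mu)=\int Q\,d\mu-\iint\log|z-w|\,\mu(dz)\,\mu(dw)\in(-\infty,+\infty],$$ and call a probability measure an equilibrium measure $\mu_Q$ of $Q$ if it minimizes $E_Q$ over all Borel probability measures on $\mathbf{T}$. For $u\in\mathbb{R}$ let $\bar\mu_u$ be the lift of $\mu$ to $[u,u+2\pi)$, i.e. the image of $\mu$ under the map that sends $z\in\mathbf{T}$ to the unique $x\in[u,u+2\pi)$ with $e^{ix}=z$. Let $$\mathcal{W}_2(\mu,\nu)=\sup\Big\{W_2(\bar\mu_u,\bar\nu_v): u,v\in[0,2\pi],\ \int x\,\bar\mu_u(dx)=\int x\,\bar\nu_v(dx)\Big\},$$ where $W_2$ is the standard Wasserstein distance on the real line and the supremum of the empty set is $+\infty$. For $\rho>0$ the potential $Q$ is said to satisfy the transportation inequality $T(\rho)$ if it has an equilibrium measure $\mu_Q$ such that $$\rho\,\mathcal{W}_2^2(\mu,\mu_Q)\le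 E_Q(\mu)-E_Q(\mu_Q)$$ for all Borel probability measures $\mu$ on $\mathbf{T}$. For $Q\equiv 0$, the Haar measure $\alpha$ is the unique equilibrium measure, and there exists $\epsilon>0$ such that $T((1+\epsilon)/4)$ holds. Consequently $T(1/4)$ holds for $Q\equiv0$ but is not sharp: $1/4$ is not the largest constant $\rho$ for which $T(\rho)$ holds. -/

import Mathlib

open MeasureTheory Set
open scoped ENNReal

noncomputable section

namespace FreeCircle

/-- The unit circle carries its Borel σ-algebra. -/
instance instMeasurableSpaceCircle : MeasurableSpace Circle := borel Circle

instance instBorelSpaceCircle : BorelSpace Circle := ⟨rfl⟩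

/-- The normalized Haar measure on the unit circle (the whole circle has mass `1`). -/
def haar : Measure Circle :=
  Measure.haarMeasure (⊤ : TopologicalSpace.PositiveCompacts Circle)

/-! ### Logarithmic energy and equilibrium measures -/

/-- The extended-valued integral `∬ log |z - w| μ(dz) μ(dw)`, with `log 0 = -∞`, as the integral
of the positive part minus the integral of the negative part. As `log |z - w| ≤ log 2` on the
circle, the first of the two is finite for a finite measure. -/
def logIntegral (μ : Measure Circle) : EReal :=
  ((∫⁻ p : Circle × Circle,
      (ENNReal.log ‖(p.1 : ℂ) - (p.2 : ℂ)‖ₑ).toENNReal ∂(μ.prod μ) : ℝ≥0∞) : EReal) -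
  ((∫⁻ p : Circle × Circle,
      (-ENNReal.log ‖(p.1 : ℂ) - (p.2 : ℂ)‖ₑ).toENNReal ∂(μ.prod μ) : ℝ≥0∞) : EReal)

/-- The logarithmic energy `E_Q(μ) = ∫ Q dμ - ∬ log |z - w| μ(dz) μ(dw)` with external field `Q`;
it takes values in `(-∞, +∞]` on probability measures. -/
def energy (Q : C(Circle, ℝ)) (μ : Measure Circle) : EReal :=
  ((∫ z, Q z ∂μ : ℝ) : EReal) - logIntegral μ

/-- `μ` minimizes the energy `E_Q` over all Borel probability measures on the circle. -/
def IsEquilibriumMeasure (Q : C(Circle, ℝ)) (μ : Measure Circle) : Prop :=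
  IsProbabilityMeasure μ ∧
    ∀ ν : Measure Circle, IsProbabilityMeasure ν → energy Q μ ≤ energy Q ν

/-! ### Lifting measures from the circle to an interval of length `2π` -/

/-- The unique `x ∈ [u, u + 2π)` with `e^{ix} = z`. -/
def lift (u : ℝ) (z : Circle) : ℝ := toIcoMod Real.two_pi_pos u (Complex.arg (z : ℂ))

theorem lift_mem (u : ℝ) (z : Circle) : lift u z ∈ Ico u (u + 2 * Real.pi) :=
  toIcoMod_mem_Ico _ _ _

theorem exp_lift (u : ℝ) (z : Circle) : Circle.exp (lift u z) = z := by
  have h : lift u z = Complex.arg (z : ℂ)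
      - toIcoDiv Real.two_pi_pos u (Complex.arg (z : ℂ)) • (2 * Real.pi) := rfl
  rw [h, Circle.periodic_exp.sub_zsmul_eq, Circle.exp_arg]

theorem lift_exp {u x : ℝ} (hx : x ∈ Ico u (u + 2 * Real.pi)) : lift u (Circle.exp x) = x := by
  obtain ⟨m, hm⟩ := Circle.exp_eq_exp.1 (Circle.exp_arg (Circle.exp x))
  exact (toIcoMod_eq_iff Real.two_pi_pos).2 ⟨hx, m, by simpa using hm⟩

theorem measurable_lift (u : ℝ) : Measurable (lift u) := by
  have h1 : Measurable fun z : Circle => Complex.arg (z : ℂ) :=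
    Complex.measurable_arg.comp (by fun_prop : Continuous fun z : Circle => (z : ℂ)).measurable
  have h2 : Measurable fun x : ℝ => toIcoMod Real.two_pi_pos u x := by
    have h3 : (fun x : ℝ => toIcoMod Real.two_pi_pos u x) =
        fun x : ℝ => x - (⌊(x - u) / (2 * Real.pi)⌋ : ℝ) * (2 * Real.pi) := by
      funext x
      rw [toIcoMod, toIcoDiv_eq_floor, zsmul_eq_mul]
    rw [h3]
    fun_prop
  exact h2.comp h1

/-- The lift of a measure on the circle to the interval `[u, u + 2π)`. -/
def liftMeasure (u : ℝ) (μ : Measure Circle) : Measure ℝ := μ.map (lift u)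

theorem liftMeasure_apply (u : ℝ) (μ : Measure Circle) {A : Set ℝ} (hA : MeasurableSet A) :
    liftMeasure u μ A = μ (Circle.exp '' (A ∩ Ico u (u + 2 * Real.pi))) := by
  rw [liftMeasure, Measure.map_apply (measurable_lift u) hA]
  congr 1
  ext z
  constructor
  · intro hz
    exact ⟨lift u z, ⟨hz, lift_mem u z⟩, exp_lift u z⟩
  · rintro ⟨x, ⟨hxA, hx⟩, rfl⟩
    simpa [lift_exp hx] using hxA

/-! ### Wasserstein distances -/

/-- `γ` is a transport plan between `μ` and `ν`. -/
def IsPlan (γ : Measure (ℝ × ℝ)) (μ ν : Measure ℝ) : Prop :=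
  γ.map Prod.fst = μ ∧ γ.map Prod.snd = ν

/-- The standard Wasserstein distance `W_p` on the real line. -/
def wasserstein (p : ℝ) (μ ν : Measure ℝ) : ℝ≥0∞ :=
  (⨅ (γ : Measure (ℝ × ℝ)) (_ : IsPlan γ μ ν), ∫⁻ q, edist q.1 q.2 ^ p ∂γ) ^ (1 / p)

/-- The Wasserstein distances between all lifts of `μ` and `ν` that have equal means. -/
def matchedDistances (p : ℝ) (μ ν : Measure Circle) : Set ℝ≥0∞ :=
  {d | ∃ u ∈ Icc (0 : ℝ) (2 * Real.pi), ∃ v ∈ Icc (0 : ℝ) (2 * Real.pi),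
    ∫ x, x ∂(liftMeasure u μ) = ∫ x, x ∂(liftMeasure v ν) ∧
    d = wasserstein p (liftMeasure u μ) (liftMeasure v ν)}

open Classical in
/-- The modified Wasserstein distance: the supremum of the Wasserstein distances between lifts with
equal means, where the supremum of the empty set is `+∞`. -/
def modWasserstein (p : ℝ) (μ ν : Measure Circle) : ℝ≥0∞ :=
  if (matchedDistances p μ ν).Nonempty then sSup (matchedDistances p μ ν) else ⊤

/-! ### The transportation inequality -/

/-- The transportation inequality `T(ρ)` for the potential `Q`. -/
def Transportation (Q : C(Circle, ℝ)) (ρ : ℝ) : Prop :=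
  0 < ρ ∧ ∃ μQ : Measure Circle, IsEquilibriumMeasure Q μQ ∧
    ∀ μ : Measure Circle, IsProbabilityMeasure μ →
      (ρ : EReal) * ((modWasserstein 2 μ μQ ^ 2 : ℝ≥0∞) : EReal) ≤ energy Q μ - energy Q μQ

end FreeCircle

end

namespace FreeCircle

/-! Let `G` be the monotone quantile map on `(0, 1)` of a lift of `μ`, and `h t = G t - (v + 2πt)`
its displacement from a lift of Haar measure; equality of the means says `∫ h = 0`. The chord
between the points with parameters `t, s` is `2 |sin y|` with `y = (G t - G s) / 2`, against `2 |sin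
a|` with `a = π (t - s)` for Haar measure, and `y - a = (h t - h s) / 2`. Monotonicity puts `a` and
`y` on the same side of `0`, inside `(0, π)` or `(-π, 0)`, where `-log |sin|` is convex.

Integrate the second-order bound for `log |sin|` at `a` over the unit square. The linear term
carries `cot a`, odd and periodic, and drops out. Since `-(log sin)'' = 1 / sin² ≥ 1`, the quadratic
term is at least `(h t - h s)² / 8`, whose integral is `(1/4) ∫ h²`: this is `T(1/4)`. The curvature
exceeds `1` away from `π / 2`, and `log_sin_le` keeps part of the excess: `1` becomes `1 + cos² a /
6`. By Bessel's inequality for the first Fourier mode (`quadraticGain_lower_bound`) the constant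
rises to `25/96 = (1 + 1/24) / 4`.

The analytic core is `integral_log_chord_le`; `exists_transport_map` turns it into a bound on the
energy. As `∫ h²` dominates the squared Wasserstein distance for every matched pair of lifts, the
transportation inequality follows. The same bound shows that Haar measure is the unique minimizer.
-/

/-! ### Strong concavity of the logarithm of the sine -/

theorem add_cube_div_three_le_tan {w : ℝ} (h0 : 0 ≤ w) (h1 : w < Real.pi / 2) :
    w + w ^ 3 / 3 ≤ Real.tan w := by
  have hcos : ∀ x ∈ Ico (0 : ℝ) (Real.pi / 2), 0 < Real.cos x := fun x hx =>
    Real.cos_pos_of_mem_Ioo ⟨by linarith [hx.1, Real.pi_pos], hx.2⟩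
  have hder : ∀ x ∈ Ico (0 : ℝ) (Real.pi / 2),
      HasDerivAt (fun x => Real.tan x - (x + x ^ 3 / 3))
        (1 / Real.cos x ^ 2 - (1 + x ^ 2)) x := by
    intro x hx
    have := (Real.hasDerivAt_tan (hcos x hx).ne').sub
      ((hasDerivAt_id x).add ((hasDerivAt_pow 3 x).div_const 3))
    refine this.congr_deriv ?_
    norm_num
  have hmono : MonotoneOn (fun x => Real.tan x - (x + x ^ 3 / 3)) (Ico (0 : ℝ) (Real.pi / 2)) := by
    refine monotoneOn_of_deriv_nonneg (convex_Ico _ _)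
      (fun x hx => (hder x hx).continuousAt.continuousWithinAt)
      (fun x hx => (hder x (interior_subset hx)).differentiableAt.differentiableWithinAt) ?_
    intro x hx
    have hx' := interior_subset hx
    rw [(hder x hx').deriv]
    have hc := hcos x hx'
    -- The derivative of the difference is `tan² x - x²`.
    have h2 : x ≤ Real.tan x := Real.le_tan hx'.1 hx'.2
    have h3 : 1 / Real.cos x ^ 2 = 1 + Real.tan x ^ 2 := by
      rw [Real.tan_eq_sin_div_cos]
      field_simp
      linarith [Real.sin_sq_add_cos_sq x]
    rw [h3]
    nlinarith [hx'.1]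
  have := hmono ⟨le_rfl, by positivity⟩ ⟨h0, h1⟩ h0
  simp at this
  linarith

/-- With `w` the half-difference and `b` the half-sum, the difference of cotangents is `2 sin w cos
w / (cos² w - cos² b)`. Replacing `sin w` by `(w + w³/3) cos w` leaves an algebraic inequality in
`cos² w`, `cos² b` and `w`. -/
theorem cot_sub_cot_lower_bound {a y : ℝ} (ha : 0 < a) (hay : a < y) (hy : y < Real.pi) :
    (1 + Real.cos a ^ 2 / 6) * (y - a) ≤
      Real.cos a / Real.sin a - Real.cos y / Real.sin y := by
  have hsa : 0 < Real.sin a := Real.sin_pos_of_pos_of_lt_pi ha (by linarith)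
  have hsy : 0 < Real.sin y := Real.sin_pos_of_pos_of_lt_pi (by linarith) hy
  have e1 : Real.cos a / Real.sin a - Real.cos y / Real.sin y =
      Real.sin (y - a) / (Real.sin a * Real.sin y) := by
    rw [Real.sin_sub]; field_simp
  obtain ⟨w, hw⟩ : ∃ w, w = (y - a) / 2 := ⟨_, rfl⟩
  obtain ⟨b, hb⟩ : ∃ b, b = (y + a) / 2 := ⟨_, rfl⟩
  have hya : y - a = 2 * w := by linarith
  have hw0 : 0 < w := by linarith
  have hcw : 0 < Real.cos w := Real.cos_pos_of_mem_Ioo ⟨by linarith [Real.pi_pos], by linarith⟩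
  have e2 : Real.sin a * Real.sin y = Real.cos w ^ 2 - Real.cos b ^ 2 := by
    have h1 : a = b - w := by linarith
    have h2 : y = b + w := by linarith
    rw [h1, h2, Real.sin_sub, Real.sin_add]
    have h3 := Real.sin_sq_add_cos_sq b
    have h4 := Real.sin_sq_add_cos_sq w
    rw [← eq_sub_iff_add_eq] at h3 h4
    ring_nf
    rw [h3, h4]; ring
  have htan := add_cube_div_three_le_tan hw0.le (by linarith : w < Real.pi / 2)
  rw [Real.tan_eq_sin_div_cos, le_div_iff₀ hcw] at htan
  rw [e1, le_div_iff₀ (mul_pos hsa hsy)]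
  have hpos := mul_pos hsa hsy
  rw [e2] at hpos ⊢
  rw [hya, Real.sin_two_mul]
  -- The cosine is 1-Lipschitz and `b - a = w`, so `cos² a` can be traded for `cos² b` at the cost
  -- of `w²`.
  have hcosa : Real.cos a ^ 2 ≤ 2 * Real.cos b ^ 2 + 2 * w ^ 2 := by
    have h1 : a = b - w := by linarith
    have h2 : |Real.cos a - Real.cos b| ≤ |a - b| := by
      simpa [Real.dist_eq] using Real.abs_cos_sub_cos_le a b
    have h3 : |a - b| = |w| := by rw [h1]; simp
    have h4 : (Real.cos a - Real.cos b) ^ 2 ≤ w ^ 2 := by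
      rw [h3] at h2; exact sq_le_sq.2 h2
    nlinarith [sq_nonneg (Real.cos a - 2 * Real.cos b)]
  obtain ⟨q, hq⟩ : ∃ q, q = Real.cos b ^ 2 := ⟨_, rfl⟩
  obtain ⟨r, hr⟩ : ∃ r, r = Real.cos w ^ 2 := ⟨_, rfl⟩
  have hr1 : r ≤ 1 := hr ▸ Real.cos_sq_le_one w
  have hq0 : 0 ≤ q := hq ▸ sq_nonneg _
  rw [← hq, ← hr] at hpos ⊢
  rw [← hq] at hcosa
  have step1 : 2 * w * (1 + w ^ 2 / 3) * r ≤ 2 * Real.sin w * Real.cos w := by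
    rw [hr]
    nlinarith
  refine le_trans ?_ step1
  have hk : 1 + Real.cos a ^ 2 / 6 ≤ 1 + (q + w ^ 2) / 3 := by linarith
  -- The gain `q r / 3` on the left is absorbed by the loss `q`, because `r ≤ 1`.
  have step2 : (1 + (q + w ^ 2) / 3) * (r - q) ≤ (1 + w ^ 2 / 3) * r := by
    nlinarith [mul_nonneg hq0 hpos.le, mul_nonneg hq0 (sq_nonneg w)]
  calc (1 + Real.cos a ^ 2 / 6) * (2 * w) * (r - q)
      ≤ (1 + (q + w ^ 2) / 3) * (2 * w) * (r - q) := by gcongr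
    _ = 2 * w * ((1 + (q + w ^ 2) / 3) * (r - q)) := by ring
    _ ≤ 2 * w * ((1 + w ^ 2 / 3) * r) := by gcongr
    _ = _ := by ring

/-- Integrates the cotangent bound from `a` to `y`. -/
theorem log_sin_le_of_lt {a y : ℝ} (ha : 0 < a) (hay : a < y) (hy : y < Real.pi) :
    Real.log (Real.sin y) ≤ Real.log (Real.sin a) + Real.cos a / Real.sin a * (y - a)
      - (1 + Real.cos a ^ 2 / 6) / 2 * (y - a) ^ 2 := by
  have hder : ∀ x ∈ Icc a y, HasDerivAt (fun x => Real.cos a / Real.sin a * (x - a)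
      - (1 + Real.cos a ^ 2 / 6) / 2 * (x - a) ^ 2 - Real.log (Real.sin x))
      (Real.cos a / Real.sin a - (1 + Real.cos a ^ 2 / 6) * (x - a)
        - Real.cos x / Real.sin x) x := by
    intro x hx
    have hs : 0 < Real.sin x :=
      Real.sin_pos_of_pos_of_lt_pi (by linarith [hx.1]) (by linarith [hx.2])
    have hd : HasDerivAt (fun x : ℝ => x - a) 1 x := (hasDerivAt_id x).sub_const a
    have := ((hd.const_mul (Real.cos a / Real.sin a)).sub
      ((hd.pow 2).const_mul ((1 + Real.cos a ^ 2 / 6) / 2))).sub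
      ((Real.hasDerivAt_sin x).log hs.ne')
    refine this.congr_deriv ?_
    norm_num
    ring
  have hmono : MonotoneOn (fun x => Real.cos a / Real.sin a * (x - a)
      - (1 + Real.cos a ^ 2 / 6) / 2 * (x - a) ^ 2 - Real.log (Real.sin x)) (Icc a y) := by
    refine monotoneOn_of_deriv_nonneg (convex_Icc _ _)
      (fun x hx => (hder x hx).continuousAt.continuousWithinAt)
      (fun x hx => (hder x (interior_subset hx)).differentiableAt.differentiableWithinAt) ?_
    intro x hx
    rw [(hder x (interior_subset hx)).deriv]
    rw [interior_Icc] at hx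
    have := cot_sub_cot_lower_bound ha hx.1 (hx.2.trans hy)
    linarith
  have := hmono (left_mem_Icc.2 hay.le) (right_mem_Icc.2 hay.le) hay.le
  simp at this
  linarith

theorem log_sin_le {a y : ℝ} (ha : a ∈ Ioo 0 Real.pi) (hy : y ∈ Ioo 0 Real.pi) :
    Real.log (Real.sin y) ≤ Real.log (Real.sin a) + Real.cos a / Real.sin a * (y - a)
      - (1 + Real.cos a ^ 2 / 6) / 2 * (y - a) ^ 2 := by
  rcases lt_trichotomy a y with h | rfl | h
  · exact log_sin_le_of_lt ha.1 h hy.2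
  · simp
  -- The reflection `x ↦ π - x` swaps the order and changes the sign of the cotangent.
  · have := log_sin_le_of_lt (a := Real.pi - a) (y := Real.pi - y) (by linarith [ha.2])
      (by linarith) (by linarith [hy.1])
    rw [Real.sin_pi_sub, Real.sin_pi_sub, Real.cos_pi_sub] at this
    refine this.trans (le_of_eq ?_)
    ring

/-- Strong convexity of `-log (2 |sin|)` on `(0, π)` and on `(-π, 0)`. -/
theorem log_two_abs_sin_le {a y : ℝ}
    (h : (a ∈ Ioo 0 Real.pi ∧ y ∈ Ioo 0 Real.pi) ∨ (-a ∈ Ioo 0 Real.pi ∧ -y ∈ Ioo 0 Real.pi)) :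
    Real.log (2 * |Real.sin y|) ≤ Real.log (2 * |Real.sin a|)
      + Real.cos a / Real.sin a * (y - a) - (1 + Real.cos a ^ 2 / 6) / 2 * (y - a) ^ 2 := by
  have key : ∀ {a y : ℝ}, a ∈ Ioo 0 Real.pi → y ∈ Ioo 0 Real.pi →
      Real.log (2 * |Real.sin y|) ≤ Real.log (2 * |Real.sin a|)
      + Real.cos a / Real.sin a * (y - a) - (1 + Real.cos a ^ 2 / 6) / 2 * (y - a) ^ 2 := by
    intro a y ha hy
    have hsa := Real.sin_pos_of_mem_Ioo ha
    have hsy := Real.sin_pos_of_mem_Ioo hy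
    rw [abs_of_pos hsa, abs_of_pos hsy, Real.log_mul two_ne_zero hsy.ne',
      Real.log_mul two_ne_zero hsa.ne']
    linarith [log_sin_le ha hy]
  rcases h with h | h
  · exact key h.1 h.2
  · have := key h.1 h.2
    simp only [Real.sin_neg, Real.cos_neg, abs_neg] at this
    refine this.trans (le_of_eq ?_)
    ring

/-! ### Averages over the unit interval, Bessel's inequality and the quadratic gain -/

/-- Lebesgue measure on the unit interval. -/
noncomputable abbrev unitMeasure : Measure ℝ := volume.restrict (Ioo 0 1)

instance : IsProbabilityMeasure unitMeasure := ⟨by simp⟩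

theorem integral_unitMeasure (f : ℝ → ℝ) :
    ∫ t, f t ∂unitMeasure = ∫ t in (0 : ℝ)..1, f t := by
  rw [intervalIntegral.integral_of_le zero_le_one, integral_Ioc_eq_integral_Ioo]

theorem integral_affine (v : ℝ) : ∫ t, (v + 2 * Real.pi * t) ∂unitMeasure = v + Real.pi := by
  rw [integral_unitMeasure, intervalIntegral.integral_add (by simp)
    (Continuous.intervalIntegrable (by fun_prop) _ _), intervalIntegral.integral_const_mul,
    integral_id, intervalIntegral.integral_const]
  norm_num
  ring

theorem integral_sub_left_of_periodic {p : ℝ → ℝ} (hp : Function.Periodic p 1) (t : ℝ) :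
    ∫ s, p (t - s) ∂unitMeasure = ∫ s in (0 : ℝ)..1, p s := by
  rw [integral_unitMeasure, intervalIntegral.integral_comp_sub_left]
  have := hp.intervalIntegral_add_eq (t - 1) 0
  simpa using this

theorem integral_sub_left_of_odd {p : ℝ → ℝ} (hp : Function.Periodic p 1)
    (hodd : ∀ x, p (-x) = -p x) (t : ℝ) : ∫ s, p (t - s) ∂unitMeasure = 0 := by
  rw [integral_sub_left_of_periodic hp]
  have h1 : ∫ s in (0 : ℝ)..1, p s = ∫ s in (-1 : ℝ)..0, p s := by
    have := hp.intervalIntegral_add_eq (-1) 0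
    simp at this
    exact this.symm
  have h2 : ∫ s in (0 : ℝ)..1, p (-s) = ∫ s in (-1 : ℝ)..0, p s := by
    simp
  simp only [hodd, intervalIntegral.integral_neg] at h2
  linarith

theorem integral_sub_right_of_odd {p : ℝ → ℝ} (hp : Function.Periodic p 1)
    (hodd : ∀ x, p (-x) = -p x) (t : ℝ) : ∫ s, p (s - t) ∂unitMeasure = 0 := by
  have : (fun s => p (s - t)) = fun s => -p (t - s) := by
    funext s; rw [← hodd]; congr 1; ring
  rw [this, integral_neg, integral_sub_left_of_odd hp hodd, neg_zero]

theorem integral_cos_mul_pi (k : ℕ) (hk : k ≠ 0) :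
    ∫ t, Real.cos (2 * Real.pi * k * t) ∂unitMeasure = 0 := by
  have h0 : 2 * Real.pi * (k : ℝ) ≠ 0 := by positivity
  rw [integral_unitMeasure, intervalIntegral.integral_comp_mul_left _ h0, integral_cos]
  have : Real.sin (2 * Real.pi * k) = 0 := by
    have := Real.sin_nat_mul_pi (2 * k)
    rw [← this]; congr 1; push_cast; ring
  simp [this]

theorem integral_sin_mul_pi (k : ℕ) (hk : k ≠ 0) :
    ∫ t, Real.sin (2 * Real.pi * k * t) ∂unitMeasure = 0 := by
  have h0 : 2 * Real.pi * (k : ℝ) ≠ 0 := by positivity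
  rw [integral_unitMeasure, intervalIntegral.integral_comp_mul_left _ h0, integral_sin]
  have : Real.cos (2 * Real.pi * k) = 1 := by
    have := Real.cos_nat_mul_two_pi k
    rw [← this]; congr 1; ring
  simp [this]

theorem integrable_unitMeasure_of_bounded {f : ℝ → ℝ} (hf : Measurable f) {B : ℝ}
    (hB : ∀ᵐ t ∂unitMeasure, |f t| ≤ B) : Integrable f unitMeasure :=
  Integrable.of_bound hf.aestronglyMeasurable B hB

/-- Bessel's inequality for the first Fourier mode. -/
theorem bessel_first_mode {h : ℝ → ℝ} (hm : Measurable h) {B : ℝ}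
    (hB : ∀ᵐ t ∂unitMeasure, |h t| ≤ B) :
    2 * (∫ t, h t * Real.cos (2 * Real.pi * t) ∂unitMeasure) ^ 2
      + 2 * (∫ t, h t * Real.sin (2 * Real.pi * t) ∂unitMeasure) ^ 2
      ≤ ∫ t, h t ^ 2 ∂unitMeasure := by
  set a := ∫ t, h t * Real.cos (2 * Real.pi * t) ∂unitMeasure with ha
  set b := ∫ t, h t * Real.sin (2 * Real.pi * t) ∂unitMeasure with hb
  have hi : Integrable h unitMeasure := integrable_unitMeasure_of_bounded hm hB
  have hi2 : Integrable (fun t => h t ^ 2) unitMeasure := by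
    refine integrable_unitMeasure_of_bounded (B := B ^ 2) (by fun_prop) ?_
    filter_upwards [hB] with t ht
    rw [abs_pow]
    exact pow_le_pow_left₀ (abs_nonneg _) ht 2
  have hic : Integrable (fun t => h t * Real.cos (2 * Real.pi * t)) unitMeasure :=
    hi.mul_bdd (c := 1) (by fun_prop) (.of_forall fun t => Real.abs_cos_le_one _)
  have his : Integrable (fun t => h t * Real.sin (2 * Real.pi * t)) unitMeasure :=
    hi.mul_bdd (c := 1) (by fun_prop) (.of_forall fun t => Real.abs_sin_le_one _)
  have hc2 : Integrable (fun t => Real.cos (2 * Real.pi * (2 : ℕ) * t)) unitMeasure :=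
    integrable_unitMeasure_of_bounded (B := 1) (by fun_prop)
      (.of_forall fun t => Real.abs_cos_le_one _)
  have hs2 : Integrable (fun t => Real.sin (2 * Real.pi * (2 : ℕ) * t)) unitMeasure :=
    integrable_unitMeasure_of_bounded (B := 1) (by fun_prop)
      (.of_forall fun t => Real.abs_sin_le_one _)
  -- The square of `h` minus its projection onto the first mode; double angles reduce its expansion
  -- to integrals that are known.
  have hnn : 0 ≤ ∫ t, (h t - 2 * a * Real.cos (2 * Real.pi * t)
      - 2 * b * Real.sin (2 * Real.pi * t)) ^ 2 ∂unitMeasure :=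
    integral_nonneg fun t => sq_nonneg _
  have e : ∀ t, (h t - 2 * a * Real.cos (2 * Real.pi * t)
      - 2 * b * Real.sin (2 * Real.pi * t)) ^ 2 =
      h t ^ 2 - 4 * a * (h t * Real.cos (2 * Real.pi * t))
        - 4 * b * (h t * Real.sin (2 * Real.pi * t))
        + (2 * a ^ 2 - 2 * b ^ 2) * Real.cos (2 * Real.pi * (2 : ℕ) * t)
        + 4 * a * b * Real.sin (2 * Real.pi * (2 : ℕ) * t) + (2 * a ^ 2 + 2 * b ^ 2) := by
    intro t
    have h1 : 2 * Real.pi * (2 : ℕ) * t = 2 * (2 * Real.pi * t) := by push_cast; ring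
    rw [h1, Real.cos_two_mul, Real.sin_two_mul]
    have h2 := Real.sin_sq_add_cos_sq (2 * Real.pi * t)
    linear_combination 4 * b ^ 2 * h2
  simp_rw [e] at hnn
  have i1 := hi2.sub (hic.const_mul (4 * a))
  have i2 := i1.sub (his.const_mul (4 * b))
  have i3 := i2.add (hc2.const_mul (2 * a ^ 2 - 2 * b ^ 2))
  have i4 := i3.add (hs2.const_mul (4 * a * b))
  have hval := integral_add' i4 (integrable_const (2 * a ^ 2 + 2 * b ^ 2))
  rw [integral_add' i3 (hs2.const_mul _),
    integral_add' i2 (hc2.const_mul _), integral_sub' i1 (his.const_mul _),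
    integral_sub' hi2 (hic.const_mul _), integral_const_mul, integral_const_mul,
    integral_const_mul, integral_const_mul, integral_cos_mul_pi 2 two_ne_zero,
    integral_sin_mul_pi 2 two_ne_zero, integral_const, ← ha, ← hb] at hval
  simp only [probReal_univ, one_smul] at hval
  have hnn' := hnn.trans_eq hval
  nlinarith

/-- The quadratic form produced by the strong convexity of `-log (2 |sin|)`. -/
noncomputable def quadraticGain (h : ℝ → ℝ) (q : ℝ × ℝ) : ℝ :=
  (1 + Real.cos (Real.pi * (q.1 - q.2)) ^ 2 / 6) / 8 * (h q.1 - h q.2) ^ 2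

/-- As `cos² = (1 + cos (2π(t - s))) / 2`, the constant part of the weight is `13/96` and gives
`26/96 ∫ h²`, since `h` has mean zero. The oscillating part contributes only its cross terms,
`-2/96` times the sum of the squared first cosine and sine coefficients, which is at least `-1/96 ∫
h²` by Bessel. -/
theorem quadraticGain_lower_bound {h : ℝ → ℝ} (hm : Measurable h) {B : ℝ}
    (hB : ∀ᵐ t ∂unitMeasure, |h t| ≤ B) (h0 : ∫ t, h t ∂unitMeasure = 0) :
    Integrable (quadraticGain h) (unitMeasure.prod unitMeasure) ∧
      25 / 96 * ∫ t, h t ^ 2 ∂unitMeasure ≤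
        ∫ q, quadraticGain h q ∂(unitMeasure.prod unitMeasure) := by
  have hi : Integrable h unitMeasure := integrable_unitMeasure_of_bounded hm hB
  have hi2 : Integrable (fun t => h t ^ 2) unitMeasure := by
    refine integrable_unitMeasure_of_bounded (B := B ^ 2) (by fun_prop) ?_
    filter_upwards [hB] with t ht
    rw [abs_pow]
    exact pow_le_pow_left₀ (abs_nonneg _) ht 2
  let C : ℝ → ℝ := fun t => Real.cos (2 * Real.pi * t)
  let S : ℝ → ℝ := fun t => Real.sin (2 * Real.pi * t)
  have hC1 : ∀ᵐ t ∂unitMeasure, ‖C t‖ ≤ 1 := .of_forall fun t => Real.abs_cos_le_one _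
  have hS1 : ∀ᵐ t ∂unitMeasure, ‖S t‖ ≤ 1 := .of_forall fun t => Real.abs_sin_le_one _
  have hCm : Measurable C := by fun_prop
  have hSm : Measurable S := by fun_prop
  have hC : Integrable C unitMeasure := integrable_unitMeasure_of_bounded hCm hC1
  have hS : Integrable S unitMeasure := integrable_unitMeasure_of_bounded hSm hS1
  have hhC := hi.mul_bdd (c := 1) hCm.aestronglyMeasurable hC1
  have hhS := hi.mul_bdd (c := 1) hSm.aestronglyMeasurable hS1
  have h2C := hi2.mul_bdd (c := 1) hCm.aestronglyMeasurable hC1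
  have h2S := hi2.mul_bdd (c := 1) hSm.aestronglyMeasurable hS1
  have hone : Integrable (fun _ : ℝ => (1 : ℝ)) unitMeasure := integrable_const _
  -- Every term is a product of a function of `q.1` and a function of `q.2`, so each double integral
  -- factors.
  have e : quadraticGain h = fun q : ℝ × ℝ =>
      13 / 96 * (h q.1 ^ 2 * 1) - 26 / 96 * (h q.1 * h q.2) + 13 / 96 * (1 * h q.2 ^ 2)
      + 1 / 96 * (h q.1 ^ 2 * C q.1 * C q.2) - 2 / 96 * ((h q.1 * C q.1) * (h q.2 * C q.2))
      + 1 / 96 * (C q.1 * (h q.2 ^ 2 * C q.2))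
      + 1 / 96 * (h q.1 ^ 2 * S q.1 * S q.2) - 2 / 96 * ((h q.1 * S q.1) * (h q.2 * S q.2))
      + 1 / 96 * (S q.1 * (h q.2 ^ 2 * S q.2)) := by
    funext q
    have h1 : Real.cos (Real.pi * (q.1 - q.2)) ^ 2 = (1 + C q.1 * C q.2 + S q.1 * S q.2) / 2 := by
      rw [Real.cos_sq]
      have : 2 * (Real.pi * (q.1 - q.2)) = 2 * Real.pi * q.1 - 2 * Real.pi * q.2 := by ring
      rw [this, Real.cos_sub]
      ring
    rw [quadraticGain, h1]
    ring
  have j1 := (hi2.mul_prod hone).const_mul (13 / 96)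
  have j2 := (hi.mul_prod hi).const_mul (26 / 96)
  have j3 := (hone.mul_prod hi2).const_mul (13 / 96)
  have j4 := (h2C.mul_prod hC).const_mul (1 / 96)
  have j5 := (hhC.mul_prod hhC).const_mul (2 / 96)
  have j6 := (hC.mul_prod h2C).const_mul (1 / 96)
  have j7 := (h2S.mul_prod hS).const_mul (1 / 96)
  have j8 := (hhS.mul_prod hhS).const_mul (2 / 96)
  have j9 := (hS.mul_prod h2S).const_mul (1 / 96)
  have k2 := j1.sub j2
  have k3 := k2.add j3
  have k4 := k3.add j4
  have k5 := k4.sub j5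
  have k6 := k5.add j6
  have k7 := k6.add j7
  have k8 := k7.sub j8
  have k9 := k8.add j9
  have hC0 : ∫ t, C t ∂unitMeasure = 0 := by
    simpa [C] using integral_cos_mul_pi 1 one_ne_zero
  have hS0 : ∫ t, S t ∂unitMeasure = 0 := by
    simpa [S] using integral_sin_mul_pi 1 one_ne_zero
  have hsnd : ∫ q : ℝ × ℝ, h q.2 ^ 2 ∂(unitMeasure.prod unitMeasure) =
      ∫ t, h t ^ 2 ∂unitMeasure := by
    rw [integral_fun_snd (fun t => h t ^ 2)]
    simp
  rw [e]
  refine ⟨k9, ?_⟩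
  have hval := integral_add' k8 j9
  rw [integral_sub' k7 j8, integral_add' k6 j7, integral_add' k5 j6, integral_sub' k4 j5,
    integral_add' k3 j4, integral_add' k2 j3, integral_sub' j1 j2] at hval
  simp only [integral_const_mul] at hval
  rw [integral_prod_mul (fun t => h t ^ 2) (fun _ => (1 : ℝ)), integral_prod_mul h h,
    hsnd, integral_prod_mul (fun t => h t ^ 2 * C t) C,
    integral_prod_mul (fun t => h t * C t) (fun t => h t * C t),
    integral_prod_mul C (fun t => h t ^ 2 * C t),
    integral_prod_mul (fun t => h t ^ 2 * S t) S,
    integral_prod_mul (fun t => h t * S t) (fun t => h t * S t),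
    integral_prod_mul S (fun t => h t ^ 2 * S t), hC0, hS0, h0] at hval
  have hone' : ∫ _ : ℝ, (1 : ℝ) ∂unitMeasure = 1 := by simp
  rw [hone'] at hval
  refine le_of_le_of_eq ?_ hval.symm
  have hb := bessel_first_mode hm hB
  simp only [C, S]
  nlinarith

/-! ### The chord kernel, its truncation near the diagonal, and the integrated inequality -/

/-- `log |e^{2πix} - 1|`. -/
noncomputable def logChord (x : ℝ) : ℝ := Real.log (2 * |Real.sin (Real.pi * x)|)

theorem abs_sin_pi_mul_periodic : Function.Periodic (fun x => |Real.sin (Real.pi * x)|) 1 := by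
  intro x
  simp only [mul_add, mul_one, Real.sin_add_pi, abs_neg]

theorem logChord_periodic : Function.Periodic logChord 1 := by
  intro x
  have := abs_sin_pi_mul_periodic x
  simp only at this
  rw [logChord, logChord, this]

theorem measurable_logChord : Measurable logChord := by
  unfold logChord
  exact Real.measurable_log.comp (by fun_prop)

theorem intervalIntegrable_logChord (a b : ℝ) : IntervalIntegrable logChord volume a b := by
  have h : MeromorphicOn (fun x : ℝ => 2 * Real.sin (Real.pi * x)) (uIcc a b) := by
    intro x _
    exact AnalyticAt.meromorphicAt (by fun_prop)
  have := h.intervalIntegrable_log_norm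
  convert this using 2 with x
  simp [logChord]

theorem integrable_logChord_sub :
    Integrable (fun q : ℝ × ℝ => logChord (q.1 - q.2)) (unitMeasure.prod unitMeasure) := by
  have hm : Measurable fun q : ℝ × ℝ => logChord (q.1 - q.2) :=
    measurable_logChord.comp (by fun_prop)
  rw [integrable_prod_iff hm.aestronglyMeasurable]
  constructor
  · refine .of_forall fun t => ?_
    have h := (intervalIntegrable_logChord (t - 0) (t - 1)).comp_sub_left t
    simp only [sub_sub_cancel] at h
    rw [intervalIntegrable_iff_integrableOn_Ioo_of_le zero_le_one] at h
    exact h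
  -- By periodicity the inner integral does not depend on `t`.
  · have : (fun t => ∫ s, ‖logChord (t - s)‖ ∂unitMeasure) =
        fun _ => ∫ s in (0 : ℝ)..1, ‖logChord s‖ := by
      funext t
      exact integral_sub_left_of_periodic (p := fun x => ‖logChord x‖)
        (fun x => by simp only [logChord_periodic x]) t
    rw [this]
    exact integrable_const _

theorem mem_Ioo_and_ne_ae :
    ∀ᵐ q : ℝ × ℝ ∂(unitMeasure.prod unitMeasure),
      q.1 ∈ Ioo (0 : ℝ) 1 ∧ q.2 ∈ Ioo (0 : ℝ) 1 ∧ q.1 ≠ q.2 := by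
  have hms : MeasurableSet {q : ℝ × ℝ | q.1 ∈ Ioo (0 : ℝ) 1 ∧ q.2 ∈ Ioo (0 : ℝ) 1 ∧ q.1 ≠ q.2} :=
    (measurable_fst measurableSet_Ioo).inter ((measurable_snd measurableSet_Ioo).inter
      (measurableSet_eq_fun measurable_fst measurable_snd).compl)
  rw [Measure.ae_prod_iff_ae_ae hms]
  filter_upwards [ae_restrict_mem measurableSet_Ioo] with t ht
  filter_upwards [ae_restrict_mem measurableSet_Ioo,
    ae_restrict_of_ae (measure_eq_zero_iff_ae_notMem.1 (measure_singleton (μ := volume) t))]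
    with s hs hts
  exact ⟨ht, hs, fun h => hts (by simp [h])⟩

/-- `logChord` replaced by the constant `20` where `|sin (π x)| < δ`. -/
noncomputable def cutLogChord (δ x : ℝ) : ℝ :=
  if δ ≤ |Real.sin (Real.pi * x)| then logChord x else 20

/-- Half the cotangent of `π x`, replaced by `0` where `|sin (π x)| < δ`. -/
noncomputable def cutCot (δ x : ℝ) : ℝ :=
  if δ ≤ |Real.sin (Real.pi * x)| then
    Real.cos (Real.pi * x) / Real.sin (Real.pi * x) / 2 else 0

theorem measurableSet_le_abs_sin (δ : ℝ) :
    MeasurableSet {x : ℝ | δ ≤ |Real.sin (Real.pi * x)|} :=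
  measurableSet_le measurable_const (by fun_prop)

theorem measurable_cutLogChord (δ : ℝ) : Measurable (cutLogChord δ) :=
  Measurable.ite (measurableSet_le_abs_sin δ) measurable_logChord measurable_const

theorem measurable_cutCot (δ : ℝ) : Measurable (cutCot δ) := by
  refine Measurable.ite (measurableSet_le_abs_sin δ) ?_ measurable_const
  exact (Measurable.div (by fun_prop) (by fun_prop)).div_const 2

theorem cutCot_periodic (δ : ℝ) : Function.Periodic (cutCot δ) 1 := by
  intro x
  simp only [cutCot, mul_add, mul_one, Real.sin_add_pi, abs_neg, Real.cos_add_pi, neg_div_neg_eq]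

theorem cutCot_neg (δ x : ℝ) : cutCot δ (-x) = -cutCot δ x := by
  simp only [cutCot, mul_neg, Real.sin_neg, abs_neg, Real.cos_neg, div_neg, neg_div]
  split_ifs <;> simp

theorem abs_cutCot_le {δ : ℝ} (hδ : 0 < δ) (x : ℝ) : |cutCot δ x| ≤ 1 / δ := by
  rw [cutCot]
  split_ifs with h
  · rw [abs_div, abs_div, abs_two, div_div]
    have h1 := Real.abs_cos_le_one (Real.pi * x)
    have h2 := abs_nonneg (Real.sin (Real.pi * x))
    exact div_le_div₀ zero_le_one h1 hδ (by linarith)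
  · simpa using hδ.le

theorem abs_cutLogChord_le (δ x : ℝ) : |cutLogChord δ x| ≤ |logChord x| + 20 := by
  rw [cutLogChord]
  split_ifs
  · linarith
  · rw [abs_of_pos (by norm_num : (0 : ℝ) < 20)]
    linarith [abs_nonneg (logChord x)]

/-- Each half is integrated first over the variable that `h` does not see, where the odd periodic
kernel averages to zero. The truncation makes this legitimate: the full cotangent of `π (t - s)` is
not integrable on the square. -/
theorem integral_cutCot_mul_sub {δ : ℝ} (hδ : 0 < δ) {h : ℝ → ℝ}
    (hi : Integrable h unitMeasure) :
    Integrable (fun q : ℝ × ℝ => cutCot δ (q.1 - q.2) * (h q.1 - h q.2))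
      (unitMeasure.prod unitMeasure) ∧
    ∫ q : ℝ × ℝ, cutCot δ (q.1 - q.2) * (h q.1 - h q.2) ∂(unitMeasure.prod unitMeasure) = 0 := by
  have hm : Measurable fun q : ℝ × ℝ => cutCot δ (q.1 - q.2) :=
    (measurable_cutCot δ).comp (by fun_prop)
  have hb : ∀ᵐ q : ℝ × ℝ ∂(unitMeasure.prod unitMeasure), ‖cutCot δ (q.1 - q.2)‖ ≤ 1 / δ :=
    .of_forall fun q => abs_cutCot_le hδ _
  have i1 : Integrable (fun q : ℝ × ℝ => cutCot δ (q.1 - q.2) * h q.1)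
      (unitMeasure.prod unitMeasure) := (hi.comp_fst unitMeasure).bdd_mul hm.aestronglyMeasurable hb
  have i2 : Integrable (fun q : ℝ × ℝ => cutCot δ (q.1 - q.2) * h q.2)
      (unitMeasure.prod unitMeasure) := (hi.comp_snd unitMeasure).bdd_mul hm.aestronglyMeasurable hb
  simp only [mul_sub]
  refine ⟨i1.sub i2, ?_⟩
  rw [integral_sub i1 i2, integral_prod _ i1, integral_prod_symm _ i2]
  simp only [integral_mul_const, integral_sub_left_of_odd (cutCot_periodic δ) (cutCot_neg δ),
    integral_sub_right_of_odd (cutCot_periodic δ) (cutCot_neg δ), zero_mul, integral_zero, sub_zero]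

theorem integrable_cutLogChord_sub (δ : ℝ) :
    Integrable (fun q : ℝ × ℝ => cutLogChord δ (q.1 - q.2)) (unitMeasure.prod unitMeasure) := by
  have hm : Measurable fun q : ℝ × ℝ => cutLogChord δ (q.1 - q.2) :=
    (measurable_cutLogChord δ).comp (by fun_prop)
  refine (integrable_logChord_sub.abs.add (integrable_const 20)).mono' hm.aestronglyMeasurable ?_
  exact .of_forall fun q => abs_cutLogChord_le δ _

theorem sin_pi_mul_sub_ne_zero {t s : ℝ} (ht : t ∈ Ioo (0 : ℝ) 1) (hs : s ∈ Ioo (0 : ℝ) 1)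
    (hts : t ≠ s) : Real.sin (Real.pi * (t - s)) ≠ 0 := by
  rcases lt_or_gt_of_ne hts with h | h
  · refine (Real.sin_neg_of_neg_of_neg_pi_lt ?_ ?_).ne
    · nlinarith [Real.pi_pos]
    · nlinarith [Real.pi_pos, ht.1, hs.2]
  · refine (Real.sin_pos_of_pos_of_lt_pi ?_ ?_).ne'
    · nlinarith [Real.pi_pos]
    · nlinarith [Real.pi_pos, ht.2, hs.1]

theorem tendsto_integral_cutLogChord :
    Filter.Tendsto (fun n : ℕ => ∫ q : ℝ × ℝ, cutLogChord (1 / ((n : ℝ) + 1)) (q.1 - q.2)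
      ∂(unitMeasure.prod unitMeasure)) Filter.atTop
      (nhds (∫ q : ℝ × ℝ, logChord (q.1 - q.2) ∂(unitMeasure.prod unitMeasure))) := by
  refine tendsto_integral_of_dominated_convergence
    (fun q : ℝ × ℝ => |logChord (q.1 - q.2)| + 20)
    (fun n => (integrable_cutLogChord_sub _).aestronglyMeasurable)
    (integrable_logChord_sub.abs.add (integrable_const 20))
    (fun n => .of_forall fun q => abs_cutLogChord_le _ _) ?_
  filter_upwards [mem_Ioo_and_ne_ae] with q hq
  have h0 : 0 < |Real.sin (Real.pi * (q.1 - q.2))| :=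
    abs_pos.2 (sin_pi_mul_sub_ne_zero hq.1 hq.2.1 hq.2.2)
  refine tendsto_const_nhds.congr' ?_
  have := (tendsto_one_div_add_atTop_nhds_zero_nat (𝕜 := ℝ)).eventually (gt_mem_nhds h0)
  filter_upwards [this] with n hn
  rw [cutLogChord, if_pos hn.le]

/-- Where the kernel is cut, the constant `20` pays for everything: the left side is at most `1`,
and the quadratic loss is at most `(7/48) · 4 · 3.15² < 6`. Thus the quadratic gain survives on the
whole square for every `δ`. -/
theorem log_two_abs_sin_le_cut {δ a' y d : ℝ} (hd : y - Real.pi * a' = d / 2)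
    (h : (Real.pi * a' ∈ Ioo 0 Real.pi ∧ y ∈ Ioo 0 Real.pi) ∨
      (-(Real.pi * a') ∈ Ioo 0 Real.pi ∧ -y ∈ Ioo 0 Real.pi)) :
    Real.log (2 * |Real.sin y|) ≤ cutLogChord δ a' + cutCot δ a' * d
      - (1 + Real.cos (Real.pi * a') ^ 2 / 6) / 8 * d ^ 2 := by
  rw [cutLogChord, cutCot]
  split_ifs with hδ
  · have := log_two_abs_sin_le h
    rw [hd] at this
    rw [logChord]
    refine this.trans (le_of_eq ?_)
    ring
  · have h1 : Real.log (2 * |Real.sin y|) ≤ 1 := by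
      have : 2 * |Real.sin y| ≤ 2 := by linarith [Real.abs_sin_le_one y]
      have := Real.log_le_sub_one_of_pos (x := 2 * |Real.sin y|) ?_
      · linarith
      · have : Real.sin y ≠ 0 := by
          rcases h with h | h
          · exact (Real.sin_pos_of_mem_Ioo h.2).ne'
          · have := (Real.sin_pos_of_mem_Ioo h.2).ne'
            simpa using this
        positivity
    have h2 : d ^ 2 ≤ 4 * 3.15 ^ 2 := by
      have hp := Real.pi_lt_d2
      have : |d| ≤ 2 * 3.15 := by
        rw [abs_le]
        rcases h with h | h <;> obtain ⟨⟨_, _⟩, ⟨_, _⟩⟩ := h <;> constructor <;> linarith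
      nlinarith [sq_abs d, abs_nonneg d]
    have h3 := Real.cos_sq_le_one (Real.pi * a')
    have h4 : Real.cos (Real.pi * a') ^ 2 * d ^ 2 ≤ d ^ 2 :=
      mul_le_of_le_one_left (sq_nonneg d) h3
    nlinarith

/-- A monotone transport map from the uniform distribution on `[v, v + 2π)` decreases the
integrated logarithm of the chord length by at least `25 / 96` times the transport cost. -/
theorem integral_log_chord_le {G : ℝ → ℝ} {u v : ℝ} (hG : Measurable G)
    (hmono : MonotoneOn G (Ioo 0 1)) (hrange : ∀ t ∈ Ioo (0 : ℝ) 1, G t ∈ Icc u (u + 2 * Real.pi))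
    (hmean : ∫ t, G t ∂unitMeasure = v + Real.pi)
    (hint : Integrable (fun q : ℝ × ℝ => Real.log (2 * |Real.sin ((G q.1 - G q.2) / 2)|))
      (unitMeasure.prod unitMeasure))
    (hne : ∀ᵐ q : ℝ × ℝ ∂(unitMeasure.prod unitMeasure), Real.sin ((G q.1 - G q.2) / 2) ≠ 0) :
    ∫ q : ℝ × ℝ, Real.log (2 * |Real.sin ((G q.1 - G q.2) / 2)|) ∂(unitMeasure.prod unitMeasure)
      ≤ ∫ q : ℝ × ℝ, logChord (q.1 - q.2) ∂(unitMeasure.prod unitMeasure)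
        - 25 / 96 * ∫ t, (G t - (v + 2 * Real.pi * t)) ^ 2 ∂unitMeasure := by
  have hpi := Real.pi_pos
  set h : ℝ → ℝ := fun t => G t - (v + 2 * Real.pi * t) with hh
  have hm : Measurable h := by fun_prop
  have hae : ∀ᵐ t ∂unitMeasure, t ∈ Ioo (0 : ℝ) 1 := ae_restrict_mem measurableSet_Ioo
  have hGi : Integrable G unitMeasure := by
    refine integrable_unitMeasure_of_bounded (B := |u| + 2 * Real.pi) hG ?_
    filter_upwards [hae] with t ht
    obtain ⟨h1, h2⟩ := hrange t ht
    rw [abs_le]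
    constructor <;> linarith [neg_abs_le u, le_abs_self u]
  have hB : ∀ᵐ t ∂unitMeasure, |h t| ≤ |u| + |v| + 4 * Real.pi := by
    filter_upwards [hae] with t ht
    obtain ⟨h1, h2⟩ := hrange t ht
    have h3 : 2 * Real.pi * t ≤ 2 * Real.pi := by nlinarith [ht.2]
    have h4 : 0 ≤ 2 * Real.pi * t := by nlinarith [ht.1]
    rw [abs_le]
    constructor <;> simp only [hh] <;>
      linarith [neg_abs_le u, le_abs_self u, neg_abs_le v, le_abs_self v]
  have hid : Integrable (fun t : ℝ => v + 2 * Real.pi * t) unitMeasure := by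
    refine integrable_unitMeasure_of_bounded (B := |v| + 2 * Real.pi) (by fun_prop) ?_
    filter_upwards [hae] with t ht
    have h3 : 2 * Real.pi * t ≤ 2 * Real.pi := by nlinarith [ht.2]
    have h4 : 0 ≤ 2 * Real.pi * t := by nlinarith [ht.1]
    rw [abs_le]
    constructor <;> linarith [neg_abs_le v, le_abs_self v]
  have h0 : ∫ t, h t ∂unitMeasure = 0 := by
    rw [hh, integral_sub hGi hid, hmean, integral_affine, sub_self]
  have hi : Integrable h unitMeasure := hGi.sub hid
  obtain ⟨qi, hq⟩ := quadraticGain_lower_bound hm hB h0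
  have step : ∀ n : ℕ,
      ∫ q : ℝ × ℝ, Real.log (2 * |Real.sin ((G q.1 - G q.2) / 2)|) ∂(unitMeasure.prod unitMeasure)
      ≤ ∫ q : ℝ × ℝ, cutLogChord (1 / ((n : ℝ) + 1)) (q.1 - q.2) ∂(unitMeasure.prod unitMeasure)
        - 25 / 96 * ∫ t, h t ^ 2 ∂unitMeasure := by
    intro n
    have hδ : 0 < 1 / ((n : ℝ) + 1) := by positivity
    generalize 1 / ((n : ℝ) + 1) = δ at hδ
    obtain ⟨ci, hc⟩ := integral_cutCot_mul_sub hδ hi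
    have li := integrable_cutLogChord_sub δ
    have hle : ∫ q : ℝ × ℝ, Real.log (2 * |Real.sin ((G q.1 - G q.2) / 2)|)
          ∂(unitMeasure.prod unitMeasure)
        ≤ ∫ q : ℝ × ℝ, (cutLogChord δ (q.1 - q.2) + cutCot δ (q.1 - q.2) * (h q.1 - h q.2)
          - quadraticGain h q) ∂(unitMeasure.prod unitMeasure) := by
      refine integral_mono_ae hint ((li.add ci).sub qi) ?_
      filter_upwards [mem_Ioo_and_ne_ae, hne] with q hq hs
      obtain ⟨ht, hs', hts⟩ := hq
      refine log_two_abs_sin_le_cut (by simp only [hh]; ring) ?_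
      obtain ⟨g1, g2⟩ := hrange _ ht
      obtain ⟨g3, g4⟩ := hrange _ hs'
      -- Monotonicity and the range of `G` put the half-difference in the closed interval `[0, π]`
      -- or `[-π, 0]` on the side of `π (t - s)`; `hne` removes the endpoints.
      rcases lt_or_gt_of_ne hts with hlt | hlt
      · right
        have hGle := hmono ht hs' hlt.le
        refine ⟨⟨by nlinarith, by nlinarith [ht.1, hs'.2]⟩, ?_, ?_⟩
        · refine lt_of_le_of_ne (by linarith) fun he => hs ?_
          rw [neg_eq_zero.1 he.symm, Real.sin_zero]
        · refine lt_of_le_of_ne (by linarith) fun he => hs ?_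
          rw [neg_eq_iff_eq_neg.1 he, Real.sin_neg, Real.sin_pi, neg_zero]
      · left
        have hGle := hmono hs' ht hlt.le
        refine ⟨⟨by nlinarith, by nlinarith [ht.2, hs'.1]⟩, ?_, ?_⟩
        · refine lt_of_le_of_ne (by linarith) fun he => hs ?_
          rw [← he, Real.sin_zero]
        · refine lt_of_le_of_ne (by linarith) fun he => hs ?_
          rw [he, Real.sin_pi]
    have hval := integral_sub (li.add ci) qi
    simp only [Pi.add_apply] at hval
    rw [hval, integral_add li ci, hc] at hle
    linarith
  -- The gain does not depend on the truncation, so only the kernel passes to the limit.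
  exact ge_of_tendsto' (tendsto_integral_cutLogChord.sub_const _) step

/-! ### Quantile functions -/

/-- The quantile function of a probability measure on `ℝ`. -/
noncomputable def quantile (ν : Measure ℝ) (t : ℝ) : ℝ := sInf {x | t ≤ ProbabilityTheory.cdf ν x}

/-- Right continuity of the distribution function makes the infimum attained; the limits at `±∞`
make the set nonempty and bounded below for `t` in the open interval. -/
theorem quantile_le_iff (ν : Measure ℝ) {t : ℝ} (ht : t ∈ Ioo (0 : ℝ) 1) (x : ℝ) :
    quantile ν t ≤ x ↔ t ≤ ProbabilityTheory.cdf ν x := by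
  have hne : {x | t ≤ ProbabilityTheory.cdf ν x}.Nonempty := by
    obtain ⟨y, hy⟩ := ((ProbabilityTheory.tendsto_cdf_atTop ν).eventually
      (lt_mem_nhds ht.2)).exists
    exact ⟨y, hy.le⟩
  have hbdd : BddBelow {x | t ≤ ProbabilityTheory.cdf ν x} := by
    obtain ⟨y, hy⟩ := ((ProbabilityTheory.tendsto_cdf_atBot ν).eventually
      (gt_mem_nhds ht.1)).exists
    refine ⟨y, fun z hz => ?_⟩
    by_contra! h
    exact absurd (hz.trans (ProbabilityTheory.monotone_cdf ν h.le)) (not_le.2 hy)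
  constructor
  · intro h
    refine le_trans ?_ (ProbabilityTheory.monotone_cdf ν h)
    have hc := ((ProbabilityTheory.cdf ν).right_continuous (quantile ν t)).mono Ioi_subset_Ici_self
    refine ge_of_tendsto hc.tendsto ?_
    filter_upwards [self_mem_nhdsWithin] with y hy
    obtain ⟨z, hz, hzy⟩ := exists_lt_of_csInf_lt hne hy
    exact le_trans hz (ProbabilityTheory.monotone_cdf ν hzy.le)
  · exact fun h => csInf_le hbdd h

theorem monotoneOn_quantile (ν : Measure ℝ) : MonotoneOn (quantile ν) (Ioo 0 1) := by
  intro s hs t ht hst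
  rw [quantile_le_iff ν hs]
  exact hst.trans ((quantile_le_iff ν ht _).1 le_rfl)

/-- Every probability measure on an interval is the image of Lebesgue measure on the unit interval
under a monotone function. -/
theorem exists_monotone_map_eq (ν : Measure ℝ) [IsProbabilityMeasure ν] {a b : ℝ}
    (hν : ∀ᵐ x ∂ν, x ∈ Icc a b) :
    ∃ G : ℝ → ℝ, Measurable G ∧ MonotoneOn G (Ioo 0 1) ∧
      (∀ t ∈ Ioo (0 : ℝ) 1, G t ∈ Icc a b) ∧ unitMeasure.map G = ν := by
  classical
  -- Outside `(0, 1)` the infimum may be a default value, so `G` is set to `0` there, which keeps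
  -- measurability easy.
  set G : ℝ → ℝ := (Ioo (0 : ℝ) 1).indicator (quantile ν) with hGdef
  have hG : ∀ t ∈ Ioo (0 : ℝ) 1, G t = quantile ν t := fun t ht => indicator_of_mem ht _
  have hpre : ∀ x, G ⁻¹' Iic x ∩ Ioo 0 1 = Iic (ProbabilityTheory.cdf ν x) ∩ Ioo 0 1 := by
    intro x
    ext t
    simp only [mem_inter_iff, mem_preimage, mem_Iic]
    refine and_congr_left fun ht => ?_
    rw [hG t ht, quantile_le_iff ν ht]
  have hGm : Measurable G := by
    refine measurable_of_Iic fun x => ?_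
    have h1 : G ⁻¹' Iic x = (G ⁻¹' Iic x ∩ Ioo 0 1) ∪ (G ⁻¹' Iic x ∩ (Ioo 0 1)ᶜ) :=
      (inter_union_compl _ _).symm
    have h2 : G ⁻¹' Iic x ∩ (Ioo 0 1)ᶜ = {t : ℝ | (0 : ℝ) ≤ x} ∩ (Ioo 0 1)ᶜ := by
      ext t
      simp only [mem_inter_iff, mem_preimage, mem_Iic, mem_ofPred_eq]
      refine and_congr_left fun ht => ?_
      rw [hGdef, indicator_of_notMem ht]
    rw [h1, hpre, h2]
    exact (measurableSet_Iic.inter measurableSet_Ioo).union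
      ((MeasurableSet.const _).inter measurableSet_Ioo.compl)
  refine ⟨G, hGm, ?_, ?_, ?_⟩
  · exact (monotoneOn_quantile ν).congr fun t ht => (hG t ht).symm
  · intro t ht
    have h0 : ν (Icc a b)ᶜ = 0 := hν
    rw [hG t ht]
    constructor
    · by_contra! h
      have h1 := (quantile_le_iff ν ht _).1 le_rfl
      rw [ProbabilityTheory.cdf_eq_real] at h1
      have h2 : ν.real (Iic (quantile ν t)) = 0 := by
        rw [measureReal_eq_zero_iff]
        refine measure_mono_null ?_ h0
        exact fun x (hx : x ≤ _) hx' => absurd (hx'.1.trans hx) (not_le.2 h)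
      linarith [ht.1]
    · rw [quantile_le_iff ν ht, ProbabilityTheory.cdf_eq_real]
      have h2 : ν.real (Iic b) = 1 := by
        rw [measureReal_def, mem_ae_iff_prob_eq_one measurableSet_Iic |>.1, ENNReal.toReal_one]
        filter_upwards [hν] with x hx using hx.2
      linarith [ht.2]
  · have : IsProbabilityMeasure (unitMeasure.map G) :=
      Measure.isProbabilityMeasure_map hGm.aemeasurable
    refine Measure.ext_of_Iic _ _ fun x => ?_
    rw [Measure.map_apply hGm measurableSet_Iic, Measure.restrict_apply (hGm measurableSet_Iic),
      hpre, ← ProbabilityTheory.ofReal_cdf]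
    have h1 := ProbabilityTheory.cdf_le_one ν x
    set c := ProbabilityTheory.cdf ν x
    refine le_antisymm ?_ ?_
    · calc volume (Iic c ∩ Ioo 0 1) ≤ volume (Ioc 0 c) :=
            measure_mono fun t ht => ⟨ht.2.1, ht.1⟩
        _ = ENNReal.ofReal c := by simp
    · calc ENNReal.ofReal c = volume (Ioo 0 c) := by simp
        _ ≤ volume (Iic c ∩ Ioo 0 1) :=
            measure_mono fun t ht => ⟨ht.2.le, ht.1, ht.2.trans_le h1⟩

/-! ### The logarithmic energy as a Bochner integral -/

theorem norm_coe_exp_sub (x y : ℝ) :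
    ‖((Circle.exp x : Circle) : ℂ) - (Circle.exp y : Circle)‖ = 2 * |Real.sin ((x - y) / 2)| := by
  have h1 : ((Circle.exp x : Circle) : ℂ) - (Circle.exp y : Circle) =
      (Circle.exp y : Circle) * (Complex.exp (Complex.I * ((x - y : ℝ) : ℂ)) - 1) := by
    rw [mul_sub, mul_one, Circle.coe_exp, Circle.coe_exp, ← Complex.exp_add]
    congr 2
    push_cast
    ring
  rw [h1, norm_mul, Circle.norm_coe, one_mul, Complex.norm_exp_I_mul_ofReal_sub_one]
  simp

theorem measurable_norm_sub :
    Measurable fun p : Circle × Circle => ‖(p.1 : ℂ) - (p.2 : ℂ)‖ :=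
  Continuous.measurable (by fun_prop)

theorem measurable_log_norm_sub :
    Measurable fun p : Circle × Circle => Real.log ‖(p.1 : ℂ) - (p.2 : ℂ)‖ :=
  Real.measurable_log.comp measurable_norm_sub

theorem log_enorm_of_ne_zero {w : ℂ} (hw : ‖w‖ ≠ 0) :
    ENNReal.log ‖w‖ₑ = ((Real.log ‖w‖ : ℝ) : EReal) := by
  rw [← ofReal_norm, ENNReal.log_ofReal_of_pos (lt_of_le_of_ne (norm_nonneg _) hw.symm)]

theorem energy_zero (μ : Measure Circle) : energy 0 μ = -logIntegral μ := by
  simp [energy]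

theorem energy_zero_eq_integral {μ : Measure Circle}
    (hne : ∀ᵐ p : Circle × Circle ∂(μ.prod μ), ‖(p.1 : ℂ) - (p.2 : ℂ)‖ ≠ 0)
    (hint : Integrable (fun p : Circle × Circle => Real.log ‖(p.1 : ℂ) - (p.2 : ℂ)‖) (μ.prod μ)) :
    energy 0 μ =
      ((-∫ p : Circle × Circle, Real.log ‖(p.1 : ℂ) - (p.2 : ℂ)‖ ∂(μ.prod μ) : ℝ) : EReal) := by
  have e1 : ∫⁻ p : Circle × Circle, (ENNReal.log ‖(p.1 : ℂ) - (p.2 : ℂ)‖ₑ).toENNReal ∂(μ.prod μ) =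
      ∫⁻ p : Circle × Circle, ENNReal.ofReal (Real.log ‖(p.1 : ℂ) - (p.2 : ℂ)‖) ∂(μ.prod μ) := by
    refine lintegral_congr_ae ?_
    filter_upwards [hne] with p hp
    rw [log_enorm_of_ne_zero hp, EReal.real_coe_toENNReal]
  have e2 : ∫⁻ p : Circle × Circle,
        (-ENNReal.log ‖(p.1 : ℂ) - (p.2 : ℂ)‖ₑ).toENNReal ∂(μ.prod μ) =
      ∫⁻ p : Circle × Circle, ENNReal.ofReal (-Real.log ‖(p.1 : ℂ) - (p.2 : ℂ)‖) ∂(μ.prod μ) := by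
    refine lintegral_congr_ae ?_
    filter_upwards [hne] with p hp
    rw [log_enorm_of_ne_zero hp, ← EReal.coe_neg, EReal.real_coe_toENNReal]
  rw [energy_zero, logIntegral, e1, e2, integral_eq_lintegral_pos_part_sub_lintegral_neg_part hint]
  have f1 := hint.lintegral_lt_top.ne
  have f2 := hint.neg.lintegral_lt_top.ne
  simp only [Pi.neg_apply] at f2
  rw [EReal.coe_neg, EReal.coe_sub, ← EReal.coe_ennreal_toReal f1, ← EReal.coe_ennreal_toReal f2]

/-- The positive part of the logarithm is bounded on the circle, so finite energy controls the
negative part, which is infinite on the diagonal. -/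
theorem integrable_log_norm_sub_of_energy_ne_top {μ : Measure Circle} [IsProbabilityMeasure μ]
    (hE : energy 0 μ ≠ ⊤) :
    (∀ᵐ p : Circle × Circle ∂(μ.prod μ), ‖(p.1 : ℂ) - (p.2 : ℂ)‖ ≠ 0) ∧
    Integrable (fun p : Circle × Circle => Real.log ‖(p.1 : ℂ) - (p.2 : ℂ)‖) (μ.prod μ) := by
  have hem : Measurable fun p : Circle × Circle => ‖(p.1 : ℂ) - (p.2 : ℂ)‖ₑ := by
    have := ENNReal.measurable_ofReal.comp measurable_norm_sub
    simpa only [Function.comp_def, ofReal_norm] using this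
  have hneg : ∫⁻ p : Circle × Circle,
      (-ENNReal.log ‖(p.1 : ℂ) - (p.2 : ℂ)‖ₑ).toENNReal ∂(μ.prod μ) ≠ ⊤ := by
    intro h
    apply hE
    -- In `EReal`, subtracting `⊤` gives `⊥` whatever the first term is.
    rw [energy_zero, logIntegral, h, EReal.coe_ennreal_top, EReal.sub_top, EReal.neg_bot]
  have hmneg : Measurable fun p : Circle × Circle =>
      (-ENNReal.log ‖(p.1 : ℂ) - (p.2 : ℂ)‖ₑ).toENNReal :=
    (ENNReal.measurable_log.comp hem).neg.ereal_toENNReal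
  have hne : ∀ᵐ p : Circle × Circle ∂(μ.prod μ), ‖(p.1 : ℂ) - (p.2 : ℂ)‖ ≠ 0 := by
    filter_upwards [ae_lt_top hmneg hneg] with p hp h0
    rw [← ofReal_norm, h0] at hp
    simp at hp
  refine ⟨hne, (Real.measurable_log.comp measurable_norm_sub).aestronglyMeasurable, ?_⟩
  have hle : ∀ᵐ p : Circle × Circle ∂(μ.prod μ), ‖Real.log ‖(p.1 : ℂ) - (p.2 : ℂ)‖‖ₑ ≤
      ENNReal.ofReal 1 + (-ENNReal.log ‖(p.1 : ℂ) - (p.2 : ℂ)‖ₑ).toENNReal := by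
    filter_upwards [hne] with p hp
    have hp' := lt_of_le_of_ne (norm_nonneg _) hp.symm
    have h2 : ‖(p.1 : ℂ) - (p.2 : ℂ)‖ ≤ 2 := by
      refine (norm_sub_le _ _).trans ?_
      rw [Circle.norm_coe, Circle.norm_coe]
      norm_num
    have h3 := Real.log_le_sub_one_of_pos hp'
    rw [log_enorm_of_ne_zero hp, ← EReal.coe_neg, EReal.real_coe_toENNReal,
      ← ofReal_norm, Real.norm_eq_abs]
    rcases le_total 0 (Real.log ‖(p.1 : ℂ) - (p.2 : ℂ)‖) with h | h
    · rw [abs_of_nonneg h]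
      exact le_add_right (ENNReal.ofReal_le_ofReal (by linarith))
    · rw [abs_of_nonpos h]
      exact le_add_left le_rfl
  refine (lintegral_mono_ae hle).trans_lt ?_
  rw [lintegral_add_left measurable_const]
  refine ENNReal.add_lt_top.2 ⟨?_, lt_top_iff_ne_top.2 hneg⟩
  simp

/-! ### Parametrizations by the unit interval -/

theorem prod_map_exp {G : ℝ → ℝ} (hG : Measurable G) {μ : Measure Circle}
    (hμ : μ = unitMeasure.map fun t => Circle.exp (G t)) :
    Measurable (fun q : ℝ × ℝ => (Circle.exp (G q.1), Circle.exp (G q.2))) ∧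
    μ.prod μ = (unitMeasure.prod unitMeasure).map
      fun q : ℝ × ℝ => (Circle.exp (G q.1), Circle.exp (G q.2)) := by
  have hm : Measurable fun t => Circle.exp (G t) := Circle.exp.continuous.measurable.comp hG
  refine ⟨(hm.comp measurable_fst).prodMk (hm.comp measurable_snd), ?_⟩
  rw [hμ, Measure.map_prod_map _ _ hm hm]
  rfl

/-- The integral of the logarithm of the chord length over a pair of independent points. -/
noncomputable def chordIntegral (G : ℝ → ℝ) : ℝ :=
  ∫ q : ℝ × ℝ, Real.log (2 * |Real.sin ((G q.1 - G q.2) / 2)|) ∂(unitMeasure.prod unitMeasure)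

theorem energy_eq_neg_chordIntegral {G : ℝ → ℝ} (hG : Measurable G) {μ : Measure Circle}
    (hμ : μ = unitMeasure.map fun t => Circle.exp (G t))
    (hne : ∀ᵐ q : ℝ × ℝ ∂(unitMeasure.prod unitMeasure), Real.sin ((G q.1 - G q.2) / 2) ≠ 0)
    (hint : Integrable (fun q : ℝ × ℝ => Real.log (2 * |Real.sin ((G q.1 - G q.2) / 2)|))
      (unitMeasure.prod unitMeasure)) :
    energy 0 μ = ((-chordIntegral G : ℝ) : EReal) := by
  obtain ⟨hm, hprod⟩ := prod_map_exp hG hμ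
  have hlm := measurable_log_norm_sub
  rw [energy_zero_eq_integral, hprod, integral_map hm.aemeasurable hlm.aestronglyMeasurable,
    chordIntegral]
  · simp only [norm_coe_exp_sub]
  · rw [hprod]
    refine (ae_map_iff hm.aemeasurable
      (measurable_norm_sub (measurableSet_singleton (0 : ℝ)).compl)).2 ?_
    filter_upwards [hne] with q hq
    rw [norm_coe_exp_sub]
    simpa using hq
  · rw [hprod, integrable_map_measure hlm.aestronglyMeasurable hm.aemeasurable]
    simpa only [Function.comp_def, norm_coe_exp_sub] using hint

theorem integrable_of_energy_ne_top {G : ℝ → ℝ} (hG : Measurable G) {μ : Measure Circle}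
    [IsProbabilityMeasure μ] (hμ : μ = unitMeasure.map fun t => Circle.exp (G t))
    (hE : energy 0 μ ≠ ⊤) :
    (∀ᵐ q : ℝ × ℝ ∂(unitMeasure.prod unitMeasure), Real.sin ((G q.1 - G q.2) / 2) ≠ 0) ∧
    Integrable (fun q : ℝ × ℝ => Real.log (2 * |Real.sin ((G q.1 - G q.2) / 2)|))
      (unitMeasure.prod unitMeasure) := by
  obtain ⟨hm, hprod⟩ := prod_map_exp hG hμ
  have hlm := measurable_log_norm_sub
  obtain ⟨hne, hint⟩ := integrable_log_norm_sub_of_energy_ne_top hE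
  rw [hprod] at hne hint
  constructor
  · filter_upwards [ae_of_ae_map hm.aemeasurable hne] with q hq
    rw [norm_coe_exp_sub] at hq
    simpa using hq
  · have := (integrable_map_measure hlm.aestronglyMeasurable hm.aemeasurable).1 hint
    simpa only [Function.comp_def, norm_coe_exp_sub] using this

/-! ### Haar measure -/

theorem measurable_exp_affine (v : ℝ) :
    Measurable fun t : ℝ => Circle.exp (v + 2 * Real.pi * t) :=
  Circle.exp.continuous.measurable.comp (by fun_prop)

/-- Translation invariance on `UnitAddCircle` makes the image independent of `v`. A rotation only
changes `v`, so the image is an invariant probability measure, and Haar uniqueness applies. -/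
theorem map_exp_eq_haar (v : ℝ) :
    unitMeasure.map (fun t => Circle.exp (v + 2 * Real.pi * t)) = haar := by
  have hcm : Measurable fun x : UnitAddCircle => AddCircle.toCircle x :=
    AddCircle.continuous_toCircle.measurable
  have hmc : ∀ z : Circle, Measurable fun x : UnitAddCircle => z * AddCircle.toCircle x :=
    fun z => measurable_const.mul hcm
  have h1 : ∀ w : ℝ, unitMeasure.map (fun t => Circle.exp (w + 2 * Real.pi * t)) =
      (volume : Measure UnitAddCircle).map
        (fun x => Circle.exp w * AddCircle.toCircle x) := by
    intro w
    have hmp := UnitAddCircle.measurePreserving_mk 0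
    rw [zero_add, ← Measure.restrict_congr_set (Ioo_ae_eq_Ioc (μ := volume) (a := (0 : ℝ)) (b := 1))]
      at hmp
    rw [← hmp.map_eq, Measure.map_map (hmc _) hmp.measurable]
    congr 1
    funext t
    simp only [Function.comp_apply, AddCircle.toCircle_apply_mk, div_one, Circle.exp_add]
  have hinv : ∀ w w' : ℝ, unitMeasure.map (fun t => Circle.exp (w + 2 * Real.pi * t)) =
      unitMeasure.map (fun t => Circle.exp (w' + 2 * Real.pi * t)) := by
    intro w w'
    rw [h1 w, h1 w']
    have := (measurePreserving_add_left (volume : Measure UnitAddCircle)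
      (((w' - w) / (2 * Real.pi) : ℝ) : UnitAddCircle))
    conv_lhs => rw [← this.map_eq]
    rw [Measure.map_map (hmc _) this.measurable]
    congr 1
    funext x
    have h2 : 2 * Real.pi / 1 * ((w' - w) / (2 * Real.pi)) = w' - w := by field_simp
    simp only [Function.comp_apply, AddCircle.toCircle_add, AddCircle.toCircle_apply_mk, h2]
    rw [← mul_assoc, ← Circle.exp_add]
    congr 2
    ring
  set m := unitMeasure.map (fun t => Circle.exp (v + 2 * Real.pi * t)) with hm
  have : IsProbabilityMeasure m := Measure.isProbabilityMeasure_map (measurable_exp_affine v).aemeasurable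
  have : m.IsMulLeftInvariant := by
    constructor
    intro z
    rw [hm, Measure.map_map (measurable_const_mul z) (measurable_exp_affine v), ← hinv (Complex.arg (z : ℂ) + v) v]
    congr 1
    funext t
    simp only [Function.comp_apply]
    rw [add_assoc, Circle.exp_add (Complex.arg (z : ℂ)), Circle.exp_arg]
  rw [haar, Measure.haarMeasure_unique m ⊤]
  simp

instance isProbabilityMeasure_haar : IsProbabilityMeasure haar := by
  rw [← map_exp_eq_haar 0]
  exact Measure.isProbabilityMeasure_map
    (measurable_exp_affine 0).aemeasurable

theorem liftMeasure_haar (v : ℝ) :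
    liftMeasure v haar = unitMeasure.map fun t => v + 2 * Real.pi * t := by
  rw [← map_exp_eq_haar v, liftMeasure, Measure.map_map (measurable_lift v)
    (measurable_exp_affine v)]
  refine Measure.map_congr ?_
  filter_upwards [ae_restrict_mem measurableSet_Ioo] with t ht
  refine lift_exp ⟨?_, ?_⟩ <;> nlinarith [Real.pi_pos, ht.1, ht.2]

theorem integral_liftMeasure_haar (v : ℝ) : ∫ x, x ∂(liftMeasure v haar) = v + Real.pi := by
  rw [liftMeasure_haar, integral_map (Measurable.aemeasurable (by fun_prop))
    (Measurable.aestronglyMeasurable (by fun_prop)), integral_affine]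

theorem map_exp_liftMeasure (u : ℝ) (μ : Measure Circle) :
    (liftMeasure u μ).map (fun x => Circle.exp x) = μ := by
  rw [liftMeasure, Measure.map_map Circle.exp.continuous.measurable (measurable_lift u)]
  have : (fun x => Circle.exp x) ∘ lift u = id := by
    funext z
    exact exp_lift u z
  rw [this, Measure.map_id]

/-- The energy of the Haar measure. -/
noncomputable def haarEnergy : ℝ :=
  -∫ q : ℝ × ℝ, logChord (q.1 - q.2) ∂(unitMeasure.prod unitMeasure)

theorem energy_haar : energy 0 haar = (haarEnergy : EReal) := by
  have e : ∀ q : ℝ × ℝ, (0 + 2 * Real.pi * q.1 - (0 + 2 * Real.pi * q.2)) / 2 =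
      Real.pi * (q.1 - q.2) := fun q => by ring
  rw [energy_eq_neg_chordIntegral (G := fun t => 0 + 2 * Real.pi * t) (by fun_prop)
    (map_exp_eq_haar 0).symm, chordIntegral, haarEnergy]
  · simp only [e, logChord]
  · simp only [e]
    filter_upwards [mem_Ioo_and_ne_ae] with q hq
    exact sin_pi_mul_sub_ne_zero hq.1 hq.2.1 hq.2.2
  · simp only [e]
    exact integrable_logChord_sub

/-! ### The transportation inequality for the zero potential -/

instance isProbabilityMeasure_liftMeasure (u : ℝ) (μ : Measure Circle) [IsProbabilityMeasure μ] :
    IsProbabilityMeasure (liftMeasure u μ) :=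
  Measure.isProbabilityMeasure_map (measurable_lift u).aemeasurable

theorem ae_liftMeasure_mem (u : ℝ) (μ : Measure Circle) :
    ∀ᵐ x ∂(liftMeasure u μ), x ∈ Ico u (u + 2 * Real.pi) :=
  (ae_map_iff (measurable_lift u).aemeasurable measurableSet_Ico).2 (.of_forall (lift_mem u))

/-- A measure of finite energy is lifted by a transport map from the uniform distribution whose cost
is bounded by the excess energy. -/
theorem exists_transport_map (μ : Measure Circle) [IsProbabilityMeasure μ] (hE : energy 0 μ ≠ ⊤)
    {u v : ℝ} (hmean : ∫ x, x ∂(liftMeasure u μ) = v + Real.pi) :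
    ∃ (e : ℝ) (G : ℝ → ℝ), energy 0 μ = (e : EReal) ∧ Measurable G ∧
      unitMeasure.map G = liftMeasure u μ ∧
      Integrable (fun t => (G t - (v + 2 * Real.pi * t)) ^ 2) unitMeasure ∧
      haarEnergy + 25 / 96 * ∫ t, (G t - (v + 2 * Real.pi * t)) ^ 2 ∂unitMeasure ≤ e := by
  obtain ⟨G, hG, hmono, hrange, hmap⟩ := exists_monotone_map_eq (liftMeasure u μ)
    ((ae_liftMeasure_mem u μ).mono fun x hx => Ico_subset_Icc_self hx)
  have hμ : μ = unitMeasure.map fun t => Circle.exp (G t) := by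
    rw [← map_exp_liftMeasure u μ, ← hmap, Measure.map_map Circle.exp.continuous.measurable hG]
    rfl
  obtain ⟨hne, hint⟩ := integrable_of_energy_ne_top hG hμ hE
  have hmean' : ∫ t, G t ∂unitMeasure = v + Real.pi := by
    rw [← hmean, ← hmap, integral_map hG.aemeasurable
      (Measurable.aestronglyMeasurable (by fun_prop))]
  refine ⟨_, G, energy_eq_neg_chordIntegral hG hμ hne hint, hG, hmap, ?_, ?_⟩
  · refine integrable_unitMeasure_of_bounded (B := (|u - v| + 2 * Real.pi) ^ 2) (by fun_prop) ?_
    filter_upwards [ae_restrict_mem measurableSet_Ioo] with t ht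
    obtain ⟨h1, h2⟩ := hrange t ht
    rw [abs_pow]
    refine pow_le_pow_left₀ (abs_nonneg _) ?_ 2
    have h3 : 2 * Real.pi * t ≤ 2 * Real.pi := by nlinarith [ht.2, Real.pi_pos]
    have h4 : 0 ≤ 2 * Real.pi * t := by nlinarith [ht.1, Real.pi_pos]
    rw [abs_le]
    constructor <;> linarith [neg_abs_le (u - v), le_abs_self (u - v)]
  · have := integral_log_chord_le hG hmono hrange hmean' hint hne
    rw [haarEnergy, chordIntegral]
    linarith

/-- The joint law of `G` and `H` under the uniform measure is an admissible plan; its optimality is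
not needed. -/
theorem wasserstein_two_le {G H : ℝ → ℝ} (hG : Measurable G) (hH : Measurable H)
    (hi : Integrable (fun t => (G t - H t) ^ 2) unitMeasure) :
    wasserstein 2 (unitMeasure.map G) (unitMeasure.map H) ≤
      ENNReal.ofReal (∫ t, (G t - H t) ^ 2 ∂unitMeasure) ^ (1 / (2 : ℝ)) := by
  rw [wasserstein]
  refine ENNReal.rpow_le_rpow ?_ (by norm_num)
  have hm : Measurable fun t => (G t, H t) := hG.prodMk hH
  have hplan : IsPlan (unitMeasure.map fun t => (G t, H t)) (unitMeasure.map G)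
      (unitMeasure.map H) := by
    constructor
    · rw [Measure.map_map measurable_fst hm]; rfl
    · rw [Measure.map_map measurable_snd hm]; rfl
  refine iInf₂_le_of_le _ hplan (le_of_eq ?_)
  rw [lintegral_map (by fun_prop) hm,
    ofReal_integral_eq_lintegral_ofReal hi (.of_forall fun t => sq_nonneg _)]
  refine lintegral_congr fun t => ?_
  rw [edist_dist, Real.dist_eq, ENNReal.ofReal_rpow_of_nonneg (abs_nonneg _) (by norm_num)]
  congr 1
  rw [show (2 : ℝ) = ((2 : ℕ) : ℝ) by norm_num, Real.rpow_natCast, sq_abs]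

theorem exists_integral_liftMeasure_eq (μ : Measure Circle) : ∃ v : ℝ,
    ∫ x, x ∂(liftMeasure 0 μ) = v + Real.pi := ⟨_, (sub_add_cancel _ _).symm⟩

theorem haar_isEquilibriumMeasure : IsEquilibriumMeasure 0 haar := by
  refine ⟨inferInstance, fun ν hν => ?_⟩
  by_cases hE : energy 0 ν = ⊤
  · rw [hE]; exact le_top
  obtain ⟨v, hv⟩ := exists_integral_liftMeasure_eq ν
  obtain ⟨e, G, he, -, -, -, hle⟩ := exists_transport_map ν hE hv
  rw [he, energy_haar, EReal.coe_le_coe_iff]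
  have : 0 ≤ ∫ t, (G t - (v + 2 * Real.pi * t)) ^ 2 ∂unitMeasure :=
    integral_nonneg fun t => sq_nonneg _
  linarith

/-- A minimizer has no excess energy, so its transport cost from the uniform distribution vanishes
and `G` is almost everywhere affine. -/
theorem isEquilibriumMeasure_zero_iff (μ : Measure Circle) :
    IsEquilibriumMeasure 0 μ ↔ μ = haar := by
  refine ⟨fun ⟨hμ, hmin⟩ => ?_, fun h => h ▸ haar_isEquilibriumMeasure⟩
  have hle := hmin haar inferInstance
  rw [energy_haar] at hle
  have hE : energy 0 μ ≠ ⊤ := ne_top_of_le_ne_top (EReal.coe_ne_top _) hle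
  obtain ⟨v, hv⟩ := exists_integral_liftMeasure_eq μ
  obtain ⟨e, G, he, hG, hmap, hi, hge⟩ := exists_transport_map μ hE hv
  rw [he, EReal.coe_le_coe_iff] at hle
  have hnn : 0 ≤ ∫ t, (G t - (v + 2 * Real.pi * t)) ^ 2 ∂unitMeasure :=
    integral_nonneg fun t => sq_nonneg _
  have h0 : ∫ t, (G t - (v + 2 * Real.pi * t)) ^ 2 ∂unitMeasure = 0 := by linarith
  rw [integral_eq_zero_iff_of_nonneg (fun t => sq_nonneg _) hi] at h0
  rw [← map_exp_liftMeasure 0 μ, ← hmap, Measure.map_map Circle.exp.continuous.measurable hG,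
    ← map_exp_eq_haar v]
  refine Measure.map_congr ?_
  filter_upwards [h0] with t ht
  have : G t = v + 2 * Real.pi * t := by
    have := pow_eq_zero_iff (two_ne_zero) |>.1 ht
    linarith
  simp only [Function.comp_apply, this]

theorem lift_two_pi (z : Circle) : lift (2 * Real.pi) z = lift 0 z + 2 * Real.pi := by
  have h := lift_mem 0 z
  have h1 : Circle.exp (lift 0 z + 2 * Real.pi) = z := by
    rw [Circle.exp_add, Circle.exp_two_pi, mul_one, exp_lift]
  conv_lhs => rw [← h1]
  exact lift_exp ⟨by linarith [h.1], by linarith [h.2]⟩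

/-- Ensures that the convention `+∞` for the empty supremum never applies. The lift of Haar measure
from `v` has mean `v + π`. If the mean `m` of the lift of `μ` from `0` is at least `π`, take `v = m
- π`; otherwise lift `μ` from `2π`, which shifts the mean to `m + 2π`, and take `v = m + π`. -/
theorem matchedDistances_haar_nonempty (p : ℝ) (μ : Measure Circle) [IsProbabilityMeasure μ] :
    (matchedDistances p μ haar).Nonempty := by
  have hpi := Real.pi_pos
  have hbd : ∀ᵐ x ∂(liftMeasure 0 μ), x ∈ Icc (0 : ℝ) (2 * Real.pi) :=
    (ae_liftMeasure_mem 0 μ).mono fun x hx => by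
      rw [zero_add] at hx
      exact Ico_subset_Icc_self hx
  have hi : Integrable (fun x : ℝ => x) (liftMeasure 0 μ) := by
    refine Integrable.of_bound (Measurable.aestronglyMeasurable (by fun_prop)) (2 * Real.pi) ?_
    filter_upwards [hbd] with x hx
    rw [Real.norm_eq_abs, abs_of_nonneg hx.1]
    exact hx.2
  have h1 : ∫ x, x ∂(liftMeasure 0 μ) ∈ Icc (0 : ℝ) (2 * Real.pi) :=
    (convex_Icc (0 : ℝ) (2 * Real.pi)).integral_mem isClosed_Icc hbd hi
  rcases le_total Real.pi (∫ x, x ∂(liftMeasure 0 μ)) with h | h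
  · refine ⟨_, 0, ⟨le_rfl, by positivity⟩, (∫ x, x ∂(liftMeasure 0 μ)) - Real.pi,
      ⟨by linarith, by linarith [h1.2]⟩, ?_, rfl⟩
    rw [integral_liftMeasure_haar, sub_add_cancel]
  · refine ⟨_, 2 * Real.pi, ⟨by positivity, le_rfl⟩, (∫ x, x ∂(liftMeasure 0 μ)) + Real.pi,
      ⟨by linarith [h1.1], by linarith⟩, ?_, rfl⟩
    have h2 : liftMeasure (2 * Real.pi) μ =
        (liftMeasure 0 μ).map fun x => x + 2 * Real.pi := by
      rw [liftMeasure, liftMeasure, Measure.map_map (by fun_prop) (measurable_lift 0)]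
      congr 1
      funext z
      exact lift_two_pi z
    rw [integral_liftMeasure_haar, h2, integral_map (Measurable.aemeasurable (by fun_prop))
      (Measurable.aestronglyMeasurable (by fun_prop)), integral_add hi (integrable_const _)]
    simp
    ring

theorem modWasserstein_sq_le (μ : Measure Circle) [IsProbabilityMeasure μ] {e : ℝ}
    (he : energy 0 μ = (e : EReal)) :
    modWasserstein 2 μ haar ^ 2 ≤ ENNReal.ofReal (96 / 25 * (e - haarEnergy)) := by
  have hle : modWasserstein 2 μ haar ≤
      ENNReal.ofReal (96 / 25 * (e - haarEnergy)) ^ (1 / (2 : ℝ)) := by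
    rw [modWasserstein, if_pos (matchedDistances_haar_nonempty 2 μ)]
    refine sSup_le ?_
    rintro d ⟨u, -, v, -, hmean, rfl⟩
    rw [integral_liftMeasure_haar] at hmean
    obtain ⟨e', G, he', hG, hmap, hi, hge⟩ :=
      exists_transport_map μ (by rw [he]; exact EReal.coe_ne_top _) hmean
    obtain rfl : e = e' := EReal.coe_eq_coe_iff.1 (he.symm.trans he')
    rw [← hmap, liftMeasure_haar]
    refine (wasserstein_two_le hG (by fun_prop) hi).trans (ENNReal.rpow_le_rpow ?_ (by norm_num))
    exact ENNReal.ofReal_le_ofReal (by linarith)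
  calc modWasserstein 2 μ haar ^ 2
      ≤ (ENNReal.ofReal (96 / 25 * (e - haarEnergy)) ^ (1 / (2 : ℝ))) ^ 2 := by gcongr
    _ = ENNReal.ofReal (96 / 25 * (e - haarEnergy)) := by
        rw [← ENNReal.rpow_natCast, ← ENNReal.rpow_mul]
        norm_num

theorem transportation_zero {ρ : ℝ} (h0 : 0 < ρ) (h1 : ρ ≤ 25 / 96) : Transportation 0 ρ := by
  refine ⟨h0, haar, haar_isEquilibriumMeasure, fun μ hμ => ?_⟩
  rw [energy_haar]
  by_cases hE : energy 0 μ = ⊤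
  · rw [hE, EReal.top_sub_coe]
    exact le_top
  have hmin := haar_isEquilibriumMeasure.2 μ hμ
  obtain ⟨v, hv⟩ := exists_integral_liftMeasure_eq μ
  obtain ⟨e, -, he, -⟩ := exists_transport_map μ hE hv
  have hW := modWasserstein_sq_le μ he
  rw [he, energy_haar, EReal.coe_le_coe_iff] at hmin
  have hne : modWasserstein 2 μ haar ^ 2 ≠ ⊤ := ne_top_of_le_ne_top ENNReal.ofReal_ne_top hW
  rw [he, ← EReal.coe_ennreal_toReal hne, ← EReal.coe_mul, ← EReal.coe_sub, EReal.coe_le_coe_iff]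
  have hW' := ENNReal.toReal_le_of_le_ofReal (by linarith) hW
  calc ρ * (modWasserstein 2 μ haar ^ 2).toReal
      ≤ 25 / 96 * (96 / 25 * (e - haarEnergy)) :=
        mul_le_mul h1 hW' ENNReal.toReal_nonneg (by norm_num)
    _ = e - haarEnergy := by ring

end FreeCircle

theorem propositionp :
    (∀ μ : MeasureTheory.Measure Circle,
      FreeCircle.IsEquilibriumMeasure 0 μ ↔ μ = FreeCircle.haar) ∧
    (∃ ε : ℝ, 0 < ε ∧ FreeCircle.Transportation 0 ((1 + ε) / 4)) ∧
    (FreeCircle.Transportation 0 (1 / 4) ∧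
      ¬ IsGreatest {ρ : ℝ | FreeCircle.Transportation 0 ρ} (1 / 4)) := by
  refine ⟨FreeCircle.isEquilibriumMeasure_zero_iff,
    -- `(1 + 1/24) / 4 = 25/96`, the constant of the quadratic gain.
    ⟨1 / 24, by norm_num, FreeCircle.transportation_zero (by norm_num) (by norm_num)⟩,
    FreeCircle.transportation_zero (by norm_num) (by norm_num), fun h => ?_⟩
  have := h.2 (FreeCircle.transportation_zero (ρ := 25 / 96) (by norm_num) le_rfl)
  norm_num at this
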